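/- For $p\ge 1$ let $\|A\|_{\mathrm{op}}$ denote the largest singular value of a matrix $A\in\mathbb{R}^{p\times p}$. For $1\le s\le p$ and $M>0$ let $\mathcal{F}_s(M)$ be the set of symmetric positive semidefinite matrices $\Sigma\in\mathbb{R}^{p\times p}$ with $\|\Sigma\|_{\mathrm{op}}\le M$ for which there is a set $S\subset\{1,\dots,p\}$ with $|S|\le s$ such that, for all $i\ne j$, $\Sigma_{ij}=0$ whenever $i\notin S$ or $j\notin S$. For $\epsilon\in[0,1]$, $\Sigma\in\mathcal{F}_s(M)$ and a probability distribution $Q$ on $\mathbb{R}^p$, let $\mathbb{P}_{(\epsilon,\Sigma,Q)}$ be the joint law of $n$ i.i.d. observations $X_1,\dots,X_n$ from $(1-\epsilon)N(0,\Sigma)+\epsilon Q$. **Theorem.** Let $M>0$ and $C_1>0$. There are constants $C,c>0$, depending only on $M$ and $C_1$, such that for all integers $n\ge 1$ and $1\le s\le p$ with $p/n\le C_1$ and all $\epsilon\in[0,1]$, $$\inf_{\hat\Sigma}\ \sup_{\Sigma\in\mathcal{F}_s(M)}\ \sup_{Q}\ \mathbb{P}_{(\epsilon,\Sigma,Q)}\left\{\|\hat\Sigma-\Sigma\|_{\mathrm{op}}^2\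 \ge\ C\left(\frac{s\log\frac{ep}{s}}{n}\vee\epsilon^2\right)\right\}\ \ge\ c,$$ where the infimum is over all estimators, i.e. measurable functions $\hat\Sigma=\hat\Sigma(X_1,\dots,X_n)$ with values in $\mathbb{R}^{p\times p}$, the second supremum is over all probability distributions $Q$ on $\mathbb{R}^p$, and $a\vee b=\max(a,b)$. -/

import Mathlib

open MeasureTheory ProbabilityTheory
open scoped ENNReal

namespace SparseCov

/-- The operator norm (largest singular value) of a real square matrix, that is, the operator
norm of the linear map it induces on Euclidean space. -/
noncomputable def opNorm {p : ℕ} (A : Matrix (Fin p) (Fin p) ℝ) : ℝ :=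
  ‖Matrix.toEuclideanCLM (n := Fin p) (𝕜 := ℝ) A‖

/-- The class of covariance matrices with bounded spectrum: symmetric positive semidefinite
matrices whose largest singular value is at most `M`. -/
def boundedClass (p : ℕ) (M : ℝ) : Set (Matrix (Fin p) (Fin p) ℝ) :=
  {A | A.PosSemidef ∧ opNorm A ≤ M}

/-- The matrices supported on the block `S × S`. -/
def blockSupported {p : ℕ} (S : Finset (Fin p)) : Set (Matrix (Fin p) (Fin p) ℝ) :=
  {G | ∀ i j, i ∉ S ∨ j ∉ S → G i j = 0}

/-- The sparse covariance class: positive semidefinite matrices whose off-diagonal part is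
supported on a block `S × S` for some set `S` of at most `s` coordinates. -/
def sparseClass (p s : ℕ) : Set (Matrix (Fin p) (Fin p) ℝ) :=
  {A | A.PosSemidef ∧
    ∃ S : Finset (Fin p), S.card ≤ s ∧ A - Matrix.diagonal A.diag ∈ blockSupported S}

/-- The contaminated distribution `(1 - ε) N(0, A) + ε Q` on Euclidean space. -/
noncomputable def contaminated {p : ℕ} (ε : ℝ) (A : Matrix (Fin p) (Fin p) ℝ)
    (Q : Measure (EuclideanSpace ℝ (Fin p))) : Measure (EuclideanSpace ℝ (Fin p)) :=
  ENNReal.ofReal (1 - ε) • multivariateGaussian 0 A + ENNReal.ofReal ε • Q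

/-- The joint law of `n` independent observations from the contaminated distribution. -/
noncomputable def sampleLaw {p : ℕ} (n : ℕ) (ε : ℝ) (A : Matrix (Fin p) (Fin p) ℝ)
    (Q : Measure (EuclideanSpace ℝ (Fin p))) :
    Measure (Fin n → EuclideanSpace ℝ (Fin p)) :=
  Measure.pi fun _ => contaminated ε A Q

/-- A matrix estimator: a function of `n` observations in Euclidean space, each of whose entries
is measurable. Its values need not belong to any class of covariance matrices. -/
def IsEstimator {n p : ℕ}
    (T : (Fin n → EuclideanSpace ℝ (Fin p)) → Matrix (Fin p) (Fin p) ℝ) : Prop :=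
  ∀ i j, Measurable fun X => T X i j

/-- The minimax probability, over the covariance matrices in `Θ` and all contaminating
distributions, that the squared operator norm error of an estimator is at least `r`. -/
noncomputable def minimaxProb (n p : ℕ) (Θ : Set (Matrix (Fin p) (Fin p) ℝ)) (ε r : ℝ) : ℝ≥0∞ :=
  ⨅ (T : (Fin n → EuclideanSpace ℝ (Fin p)) → Matrix (Fin p) (Fin p) ℝ) (_ : IsEstimator T),
    ⨆ A ∈ Θ, ⨆ Q : ProbabilityMeasure (EuclideanSpace ℝ (Fin p)),
      sampleLaw n ε A (Q : Measure (EuclideanSpace ℝ (Fin p))) {X | r ≤ opNorm (T X - A) ^ 2}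

end SparseCov

namespace SparseCov

open scoped RealInnerProductSpace

/-! ### Densities of product measures -/

/-! The rate is a maximum of two terms, so it suffices to prove a lower bound for whichever term is
larger. Both bounds compare the null matrix `(M/2) I` with spiked matrices `(M/2)(I + κ² v vᵀ)`,
`‖v‖ = 1`, at operator distance at least `M κ² / 2`. If the data cannot tell them apart, every
estimator errs by half this distance under one of them.

Contamination (`minimaxProb_contamination`): take `κ² = ε`. The spiked Gaussian has density at least
`1 - ε/2` with respect to the null Gaussian (`ofReal_le_spikeDensity`), so a contaminated spiked law
dominates `1 - ε` times the null. It is therefore also a contaminated null law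
(`exists_contaminated_eq`): two parameters, one distribution.

Sparsity (`minimaxProb_sparse`): take `Q` to be the clean Gaussian and let `v` be uniform over
vectors with one signed coordinate in each of `s` blocks of size `m = ⌊p/s⌋`. The likelihood ratio
of the mixture has second moment at most the mean of `exp(n κ⁴ ⟪v, v'⟫²)`
(`lintegral_spikeDensity_mul_le`). This stays bounded for `n κ⁴` of order `s log(e m)`
(`sum_exp_overlap_sq_le`), and Le Cam's method (`exists_half_le_of_second_moment`) concludes. The
bound on `p / n` keeps `κ` small. -/

lemma lintegral_pi_prod {ι : Type*} [Fintype ι] {Ω : ι → Type*} [∀ i, MeasurableSpace (Ω i)]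
    (μ : ∀ i, Measure (Ω i)) [∀ i, IsProbabilityMeasure (μ i)] (f : ∀ i, Ω i → ℝ≥0∞)
    (hf : ∀ i, Measurable (f i)) :
    ∫⁻ x, ∏ i, f i (x i) ∂Measure.pi μ = ∏ i, ∫⁻ y, f i y ∂μ i := by
  have hind : iIndepFun (fun i (x : ∀ i, Ω i) => f i (x i)) (Measure.pi μ) :=
    iIndepFun_pi fun i => (hf i).aemeasurable
  rw [lintegral_prod_eq_prod_lintegral_of_indepFun Finset.univ _ hind
    fun i => (hf i).comp (measurable_pi_apply i)]
  refine Finset.prod_congr rfl fun i _ => ?_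
  rw [← (measurePreserving_eval μ i).map_eq, lintegral_map (hf i) (measurable_pi_apply i)]

lemma pi_withDensity {ι : Type*} [Fintype ι] {Ω : ι → Type*} [∀ i, MeasurableSpace (Ω i)]
    (μ : ∀ i, Measure (Ω i)) [∀ i, IsProbabilityMeasure (μ i)] (f : ∀ i, Ω i → ℝ≥0∞)
    (hf : ∀ i, Measurable (f i)) [∀ i, SigmaFinite ((μ i).withDensity (f i))] :
    Measure.pi (fun i => (μ i).withDensity (f i)) =
      (Measure.pi μ).withDensity fun x => ∏ i, f i (x i) := by
  refine Measure.pi_eq (μ := fun i => (μ i).withDensity (f i)) fun s hs => ?_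
  rw [withDensity_apply _ (MeasurableSet.univ_pi hs), ← lintegral_indicator (MeasurableSet.univ_pi hs)]
  have h : ∀ x, (Set.univ.pi s).indicator (fun x => ∏ i, f i (x i)) x =
      ∏ i, (s i).indicator (f i) (x i) := by
    intro x
    by_cases hx : x ∈ Set.univ.pi s
    · rw [Set.indicator_of_mem hx]
      exact Finset.prod_congr rfl fun i _ =>
        (Set.indicator_of_mem (hx i (Set.mem_univ i)) _).symm
    · rw [Set.indicator_of_notMem hx]
      simp only [Set.mem_univ_pi, not_forall] at hx
      obtain ⟨i, hi⟩ := hx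
      exact (Finset.prod_eq_zero (Finset.mem_univ i) (Set.indicator_of_notMem hi _)).symm
  simp_rw [h]
  rw [lintegral_pi_prod μ _ fun i => (hf i).indicator (hs i)]
  refine Finset.prod_congr rfl fun i _ => ?_
  rw [withDensity_apply _ (hs i), lintegral_indicator (hs i)]

lemma map_withDensity_comp {α β : Type*} [MeasurableSpace α] [MeasurableSpace β] (μ : Measure α)
    {h : α → β} (hh : Measurable h) {g : β → ℝ≥0∞} (hg : Measurable g) :
    (μ.withDensity fun x => g (h x)).map h = (μ.map h).withDensity g := by
  ext s hs
  rw [Measure.map_apply hh hs, withDensity_apply _ (hh hs), withDensity_apply _ hs,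
    setLIntegral_map hs hg hh]

/-! ### Shifts of standard Gaussian measures -/

lemma gaussianReal_eq_withDensity (w : ℝ) :
    gaussianReal w 1 = (gaussianReal 0 1).withDensity
      fun x => ENNReal.ofReal (Real.exp (w * x - w ^ 2 / 2)) := by
  rw [gaussianReal_of_var_ne_zero w one_ne_zero, gaussianReal_of_var_ne_zero 0 one_ne_zero,
    ← withDensity_mul _ (by fun_prop) (by fun_prop)]
  congr 1
  ext x
  simp only [gaussianPDF, Pi.mul_apply, gaussianPDFReal]
  rw [← ENNReal.ofReal_mul (by positivity), mul_assoc _ (Real.exp _), ← Real.exp_add]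
  congr 3
  simp
  ring

/-- The Cameron–Martin formula, obtained coordinate by coordinate from the product structure. -/
lemma stdGaussian_map_add {ι : Type*} [Fintype ι] (w : EuclideanSpace ℝ ι) :
    (stdGaussian (EuclideanSpace ℝ ι)).map (fun x => x + w) =
      (stdGaussian (EuclideanSpace ℝ ι)).withDensity
        fun x => ENNReal.ofReal (Real.exp (⟪w, x⟫ - ‖w‖ ^ 2 / 2)) := by
  have hpi : (Measure.pi fun _ : ι => gaussianReal 0 1).map (fun x i => x i + w i) =
      (Measure.pi fun _ : ι => gaussianReal 0 1).withDensity fun x =>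
        ∏ i, ENNReal.ofReal (Real.exp (w i * x i - w i ^ 2 / 2)) := by
    have : ∀ i, SigmaFinite ((gaussianReal 0 1).withDensity
        fun x => ENNReal.ofReal (Real.exp (w i * x - w i ^ 2 / 2))) := fun i => by
      rw [← gaussianReal_eq_withDensity]; infer_instance
    rw [← pi_withDensity (fun _ => gaussianReal 0 1)
      (fun i x => ENNReal.ofReal (Real.exp (w i * x - w i ^ 2 / 2))) (fun i => by fun_prop)]
    simp_rw [← gaussianReal_eq_withDensity]
    have := Measure.pi_map_pi (μ := fun _ : ι => gaussianReal 0 1) (f := fun i x => x + w i)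
      (fun i => by fun_prop)
    rw [this]
    congr 1
    ext1 i
    rw [gaussianReal_map_add_const, zero_add]
  rw [← map_pi_eq_stdGaussian, ← map_withDensity_comp _ (by fun_prop) (by fun_prop),
    Measure.map_map (by fun_prop) (by fun_prop)]
  have h1 : ((fun x => x + w) ∘ (WithLp.toLp 2) : (ι → ℝ) → EuclideanSpace ℝ ι) =
      WithLp.toLp 2 ∘ fun x i => x i + w i := by
    ext x i; simp
  rw [h1, ← Measure.map_map (by fun_prop) (by fun_prop), hpi]
  congr 2
  ext x
  rw [← ENNReal.ofReal_prod_of_nonneg fun i _ => (Real.exp_pos _).le, ← Real.exp_sum,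
    EuclideanSpace.norm_sq_eq, Finset.sum_sub_distrib, Finset.sum_div]
  simp [PiLp.inner_apply, mul_comm]

lemma lintegral_stdGaussian_exp {ι : Type*} [Fintype ι] (w : EuclideanSpace ℝ ι) :
    ∫⁻ x, ENNReal.ofReal (Real.exp (⟪w, x⟫ - ‖w‖ ^ 2 / 2))
      ∂stdGaussian (EuclideanSpace ℝ ι) = 1 := by
  have : IsProbabilityMeasure ((stdGaussian (EuclideanSpace ℝ ι)).map (fun x => x + w)) :=
    Measure.isProbabilityMeasure_map (by fun_prop)
  rw [stdGaussian_map_add] at this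
  rw [← setLIntegral_univ, ← withDensity_apply _ MeasurableSet.univ]
  exact this.measure_univ

/-! ### Spiked covariance -/

/-- The density of `N(0, I + κ² v vᵀ)` with respect to `N(0, I)`, for a unit vector `v`, as a
Gaussian mixture of shifts. -/
noncomputable def spikeDensity {ι : Type*} [Fintype ι] (κ : ℝ) (v x : EuclideanSpace ℝ ι) : ℝ≥0∞ :=
  ∫⁻ g, ENNReal.ofReal (Real.exp (κ * g * ⟪v, x⟫ - κ ^ 2 * g ^ 2 / 2)) ∂gaussianReal 0 1

lemma measurable_spikeDensity {ι : Type*} [Fintype ι] (κ : ℝ) (v : EuclideanSpace ℝ ι) :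
    Measurable (spikeDensity κ v) := by
  unfold spikeDensity
  apply Measurable.lintegral_prod_right' (f := fun p : EuclideanSpace ℝ ι × ℝ =>
    ENNReal.ofReal (Real.exp (κ * p.2 * ⟪v, p.1⟫ - κ ^ 2 * p.2 ^ 2 / 2)))
  fun_prop

/-- The covariance matrix `a (I + κ² v vᵀ)`. -/
noncomputable def spikeMatrix {p : ℕ} (a κ : ℝ) (v : EuclideanSpace ℝ (Fin p)) :
    Matrix (Fin p) (Fin p) ℝ :=
  a • (1 + κ ^ 2 • Matrix.vecMulVec (v : Fin p → ℝ) v)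

lemma spikeMatrix_posSemidef {p : ℕ} {a : ℝ} (ha : 0 ≤ a) (κ : ℝ) (v : EuclideanSpace ℝ (Fin p)) :
    (spikeMatrix a κ v).PosSemidef := by
  refine Matrix.PosSemidef.smul (Matrix.PosSemidef.one.add (Matrix.PosSemidef.smul ?_ (sq_nonneg κ))) ha
  simpa using Matrix.posSemidef_vecMulVec_self_star (v : Fin p → ℝ)

/-- Given `g`, the vector `κ g v + Z` is a shifted standard Gaussian with a Cameron–Martin density;
Tonelli averages that density over `g`. -/
lemma conv_eq_withDensity_spikeDensity {ι : Type*} [Fintype ι] (κ : ℝ) (v : EuclideanSpace ℝ ι)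
    (hv : ‖v‖ = 1) :
    ((gaussianReal 0 1).map (fun g : ℝ => (κ * g) • v)) ∗ stdGaussian (EuclideanSpace ℝ ι) =
      (stdGaussian (EuclideanSpace ℝ ι)).withDensity (spikeDensity κ v) := by
  ext s hs
  rw [← lintegral_indicator_one hs, Measure.lintegral_conv (measurable_one.indicator hs),
    lintegral_map (by
      apply Measurable.lintegral_prod_right' (f := fun p : EuclideanSpace ℝ ι × EuclideanSpace ℝ ι =>
        s.indicator (1 : EuclideanSpace ℝ ι → ℝ≥0∞) (p.1 + p.2))
      exact (measurable_one.indicator hs).comp (by fun_prop)) (by fun_prop),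
    withDensity_apply _ hs, ← lintegral_indicator hs]
  have h1 : ∀ g : ℝ, ∫⁻ y, s.indicator (1 : EuclideanSpace ℝ ι → ℝ≥0∞) ((κ * g) • v + y)
        ∂stdGaussian (EuclideanSpace ℝ ι) =
      ∫⁻ y, s.indicator 1 y * ENNReal.ofReal (Real.exp (κ * g * ⟪v, y⟫ - κ ^ 2 * g ^ 2 / 2))
        ∂stdGaussian (EuclideanSpace ℝ ι) := by
    intro g
    have h2 := lintegral_map (μ := stdGaussian (EuclideanSpace ℝ ι))
      (measurable_one.indicator hs : Measurable (s.indicator (1 : EuclideanSpace ℝ ι → ℝ≥0∞)))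
      (measurable_add_const ((κ * g) • v))
    rw [stdGaussian_map_add, lintegral_withDensity_eq_lintegral_mul _ (by fun_prop)
      (measurable_one.indicator hs)] at h2
    simp_rw [add_comm ((κ * g) • v)]
    rw [← h2]
    refine lintegral_congr fun y => ?_
    simp only [Pi.mul_apply, real_inner_smul_left, norm_smul, hv]
    rw [mul_comm]
    congr 4
    simp [mul_pow]
  simp_rw [h1]
  rw [lintegral_lintegral_swap]
  · refine lintegral_congr fun y => ?_
    rw [lintegral_const_mul _ (by fun_prop)]
    by_cases hy : y ∈ s <;> simp [hy, spikeDensity]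
  · refine AEMeasurable.mul ?_ (by fun_prop)
    exact ((measurable_one.indicator hs).comp measurable_snd).aemeasurable

/-- Characteristic functions identify the Gaussian with the law of `√a (κ g v + Z)`, whose density
is known before scaling. -/
lemma multivariateGaussian_spikeMatrix {p : ℕ} {a : ℝ} (ha : 0 < a) (κ : ℝ)
    (v : EuclideanSpace ℝ (Fin p)) (hv : ‖v‖ = 1) :
    multivariateGaussian 0 (spikeMatrix a κ v) =
      ((stdGaussian (EuclideanSpace ℝ (Fin p))).map (fun x => √a • x)).withDensity
        fun x => spikeDensity κ v ((√a)⁻¹ • x) := by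
  have hsa : √a ≠ 0 := (Real.sqrt_pos.2 ha).ne'
  rw [← map_withDensity_comp _ (by fun_prop) (g := fun x => spikeDensity κ v ((√a)⁻¹ • x))
    ((measurable_spikeDensity κ v).comp (measurable_const_smul _))]
  simp_rw [smul_smul, inv_mul_cancel₀ hsa, one_smul]
  rw [← conv_eq_withDensity_spikeDensity κ v hv]
  have : IsProbabilityMeasure ((gaussianReal 0 1).map (fun g : ℝ => (κ * g) • v)) :=
    Measure.isProbabilityMeasure_map (by fun_prop)
  have : IsProbabilityMeasure ((((gaussianReal 0 1).map (fun g : ℝ => (κ * g) • v)) ∗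
    stdGaussian (EuclideanSpace ℝ (Fin p))).map (fun x => √a • x)) :=
    Measure.isProbabilityMeasure_map (by fun_prop)
  apply Measure.ext_of_charFun
  ext t
  rw [charFun_multivariateGaussian (spikeMatrix_posSemidef ha.le κ v), charFun_map_smul,
    charFun_conv, charFun_stdGaussian]
  have h1 : charFun ((gaussianReal 0 1).map (fun g : ℝ => (κ * g) • v)) (√a • t) =
      charFun (gaussianReal 0 1) (√a * κ * ⟪v, t⟫) := by
    rw [charFun_apply, integral_map (by fun_prop) (by fun_prop), charFun_apply_real]
    congr 1
    ext g
    rw [real_inner_smul_left, real_inner_smul_right]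
    push_cast
    congr 1
    ring
  have h2 : (t : Fin p → ℝ) ⬝ᵥ (spikeMatrix a κ v).mulVec t = a * ‖t‖ ^ 2 +
      a * κ ^ 2 * ⟪v, t⟫ ^ 2 := by
    have h3 : (v : Fin p → ℝ) ⬝ᵥ t = ⟪v, t⟫ := by
      simp [PiLp.inner_apply, dotProduct, mul_comm]
    have h4 : (t : Fin p → ℝ) ⬝ᵥ t = ‖t‖ ^ 2 := by
      rw [EuclideanSpace.real_norm_sq_eq]
      simp [dotProduct, pow_two]
    rw [spikeMatrix, Matrix.smul_mulVec, Matrix.add_mulVec, Matrix.smul_mulVec, Matrix.one_mulVec,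
      Matrix.vecMulVec_mulVec, dotProduct_smul, dotProduct_add, dotProduct_smul, h4]
    simp only [smul_eq_mul, op_smul_eq_smul, dotProduct_smul, h3]
    rw [dotProduct_comm, h3]
    ring
  rw [h1, charFun_gaussianReal, h2, ← Complex.exp_add, norm_smul]
  have h5 : (√a : ℂ) ^ 2 = a := by
    rw [← Complex.ofReal_pow, Real.sq_sqrt ha.le]
  simp only [inner_zero_right, Real.norm_eq_abs, abs_of_nonneg (Real.sqrt_nonneg a)]
  push_cast
  congr 1
  simp only [mul_pow, h5]
  ring

/-- Writing the null model as a spike of strength zero gives it the same form as the alternatives.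
-/
lemma stdGaussian_map_smul_eq {p : ℕ} {a : ℝ} (ha : 0 < a) (v : EuclideanSpace ℝ (Fin p)) :
    (stdGaussian (EuclideanSpace ℝ (Fin p))).map (fun x => √a • x) =
      multivariateGaussian 0 (spikeMatrix a 0 v) := by
  have : IsProbabilityMeasure ((stdGaussian (EuclideanSpace ℝ (Fin p))).map (fun x => √a • x)) :=
    Measure.isProbabilityMeasure_map (by fun_prop)
  apply Measure.ext_of_charFun
  ext t
  rw [charFun_multivariateGaussian (spikeMatrix_posSemidef ha.le 0 v), charFun_map_smul,
    charFun_stdGaussian]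
  have h4 : (t : Fin p → ℝ) ⬝ᵥ t = ‖t‖ ^ 2 := by
    rw [EuclideanSpace.real_norm_sq_eq]
    simp [dotProduct, pow_two]
  have h5 : (√a : ℂ) ^ 2 = a := by
    rw [← Complex.ofReal_pow, Real.sq_sqrt ha.le]
  simp only [spikeMatrix, norm_smul, Real.norm_eq_abs, abs_of_nonneg (Real.sqrt_nonneg a)]
  simp [Matrix.smul_mulVec, h4, mul_pow, h5]
  ring_nf

/-! ### Moments of the spiked density -/

lemma lintegral_gaussianReal_exp_mul (b : ℝ) :
    ∫⁻ g, ENNReal.ofReal (Real.exp (b * g)) ∂gaussianReal 0 1 =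
      ENNReal.ofReal (Real.exp (b ^ 2 / 2)) := by
  rw [← ofReal_integral_eq_lintegral_ofReal (integrable_exp_mul_gaussianReal b)
    (Filter.Eventually.of_forall fun _ => (Real.exp_pos _).le)]
  have := mgf_gaussianReal (p := gaussianReal 0 1) (X := id) (μ := 0) (v := 1) (by simp) b
  simp only [mgf, id] at this
  rw [this]
  simp

/-- The integral equals `(1 - τ)^(-1/2)`, and `(1 - τ)(1 + 2τ) ≥ 1` for `0 ≤ τ ≤ 1/2`. -/
lemma lintegral_gaussianReal_exp_sq_le {τ : ℝ} (hτ : 0 ≤ τ) (hτ' : τ ≤ 1 / 2) :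
    ∫⁻ g, ENNReal.ofReal (Real.exp (τ * g ^ 2 / 2)) ∂gaussianReal 0 1 ≤
      ENNReal.ofReal (Real.exp τ) := by
  rw [gaussianReal_of_var_ne_zero 0 one_ne_zero,
    lintegral_withDensity_eq_lintegral_mul _ (by fun_prop) (by fun_prop)]
  have h1 : ∀ g : ℝ, (gaussianPDF 0 1 * fun g => ENNReal.ofReal (Real.exp (τ * g ^ 2 / 2))) g =
      ENNReal.ofReal ((√(2 * Real.pi))⁻¹ * Real.exp (-((1 - τ) / 2) * g ^ 2)) := by
    intro g
    simp only [gaussianPDF, Pi.mul_apply, gaussianPDFReal]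
    rw [← ENNReal.ofReal_mul (by positivity), mul_assoc _ (Real.exp _), ← Real.exp_add]
    congr 3
    · simp
    · simp; ring
  simp_rw [h1]
  rw [← ofReal_integral_eq_lintegral_ofReal
    ((integrable_exp_neg_mul_sq (by linarith)).const_mul _)
    (Filter.Eventually.of_forall fun _ => by positivity)]
  refine ENNReal.ofReal_le_ofReal ?_
  rw [integral_const_mul, integral_gaussian, ← Real.sqrt_inv, ← Real.sqrt_mul (by positivity)]
  refine Real.sqrt_le_iff.2 ⟨(Real.exp_pos _).le, ?_⟩
  have h2 : (2 * Real.pi)⁻¹ * (Real.pi / ((1 - τ) / 2)) = 1 / (1 - τ) := by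
    have := Real.pi_pos
    have : 1 - τ ≠ 0 := by linarith
    field_simp
  rw [h2, div_le_iff₀ (by linarith), ← Real.exp_nat_mul]
  have h3 := Real.add_one_le_exp (((2 : ℕ) : ℝ) * τ)
  push_cast at h3 ⊢
  nlinarith

section

variable {ι : Type*} [Fintype ι]

/-- The product of the shift densities for `w = κ g v` and `w' = κ g' v'` is `exp ⟪w, w'⟫` times the
density of the shift by `w + w'`. Integrating over `x`, then `g'`, then `g` leaves a Gaussian
integral with `τ = κ⁴ ⟪v, v'⟫²`. -/
lemma lintegral_spikeDensity_mul_le {κ : ℝ} (hκ : κ ^ 4 ≤ 1 / 2) {v v' : EuclideanSpace ℝ ι}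
    (hv : ‖v‖ = 1) (hv' : ‖v'‖ = 1) :
    ∫⁻ x, spikeDensity κ v x * spikeDensity κ v' x ∂stdGaussian (EuclideanSpace ℝ ι) ≤
      ENNReal.ofReal (Real.exp (κ ^ 4 * ⟪v, v'⟫ ^ 2)) := by
  have hexp : ∀ (g g' : ℝ) (x : EuclideanSpace ℝ ι),
      ENNReal.ofReal (Real.exp (κ * g * ⟪v, x⟫ - κ ^ 2 * g ^ 2 / 2)) *
        ENNReal.ofReal (Real.exp (κ * g' * ⟪v', x⟫ - κ ^ 2 * g' ^ 2 / 2)) =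
      ENNReal.ofReal (Real.exp (κ ^ 2 * ⟪v, v'⟫ * g * g')) *
        ENNReal.ofReal (Real.exp (⟪(κ * g) • v + (κ * g') • v', x⟫ -
          ‖(κ * g) • v + (κ * g') • v'‖ ^ 2 / 2)) := by
    intro g g' x
    rw [← ENNReal.ofReal_mul (Real.exp_pos _).le, ← ENNReal.ofReal_mul (Real.exp_pos _).le,
      ← Real.exp_add, ← Real.exp_add]
    congr 2
    rw [norm_add_sq_real, inner_add_left]
    simp only [real_inner_smul_left, real_inner_smul_right, norm_smul, hv, hv', mul_one,
      Real.norm_eq_abs, sq_abs]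
    ring
  calc ∫⁻ x, spikeDensity κ v x * spikeDensity κ v' x ∂stdGaussian (EuclideanSpace ℝ ι)
      = ∫⁻ x, ∫⁻ g, ∫⁻ g', ENNReal.ofReal (Real.exp (κ * g * ⟪v, x⟫ - κ ^ 2 * g ^ 2 / 2)) *
          ENNReal.ofReal (Real.exp (κ * g' * ⟪v', x⟫ - κ ^ 2 * g' ^ 2 / 2))
          ∂gaussianReal 0 1 ∂gaussianReal 0 1 ∂stdGaussian (EuclideanSpace ℝ ι) := by
        refine lintegral_congr fun x => ?_
        rw [spikeDensity, ← lintegral_mul_const _ (by fun_prop)]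
        refine lintegral_congr fun g => ?_
        rw [spikeDensity, lintegral_const_mul _ (by fun_prop)]
    _ = ∫⁻ g, ∫⁻ g', ∫⁻ x, ENNReal.ofReal (Real.exp (κ * g * ⟪v, x⟫ - κ ^ 2 * g ^ 2 / 2)) *
          ENNReal.ofReal (Real.exp (κ * g' * ⟪v', x⟫ - κ ^ 2 * g' ^ 2 / 2))
          ∂stdGaussian (EuclideanSpace ℝ ι) ∂gaussianReal 0 1 ∂gaussianReal 0 1 := by
        rw [lintegral_lintegral_swap]
        · refine lintegral_congr fun g => ?_
          rw [lintegral_lintegral_swap]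
          fun_prop
        · apply Measurable.aemeasurable
          apply Measurable.lintegral_prod_right' (f := fun q : (EuclideanSpace ℝ ι × ℝ) × ℝ =>
            ENNReal.ofReal (Real.exp (κ * q.1.2 * ⟪v, q.1.1⟫ - κ ^ 2 * q.1.2 ^ 2 / 2)) *
            ENNReal.ofReal (Real.exp (κ * q.2 * ⟪v', q.1.1⟫ - κ ^ 2 * q.2 ^ 2 / 2)))
          fun_prop
    _ = ∫⁻ g, ENNReal.ofReal (Real.exp ((κ ^ 4 * ⟪v, v'⟫ ^ 2) * g ^ 2 / 2)) ∂gaussianReal 0 1 := by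
        refine lintegral_congr fun g => ?_
        simp_rw [hexp]
        have : ∀ g' : ℝ, ∫⁻ x, ENNReal.ofReal (Real.exp (κ ^ 2 * ⟪v, v'⟫ * g * g')) *
            ENNReal.ofReal (Real.exp (⟪(κ * g) • v + (κ * g') • v', x⟫ -
            ‖(κ * g) • v + (κ * g') • v'‖ ^ 2 / 2)) ∂stdGaussian (EuclideanSpace ℝ ι) =
            ENNReal.ofReal (Real.exp (κ ^ 2 * ⟪v, v'⟫ * g * g')) := fun g' => by
          rw [lintegral_const_mul _ (by fun_prop), lintegral_stdGaussian_exp, mul_one]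
        simp_rw [this]
        rw [lintegral_gaussianReal_exp_mul]
        congr 2
        ring
    _ ≤ _ := by
        refine lintegral_gaussianReal_exp_sq_le (by positivity) ?_
        have h1 : ⟪v, v'⟫ ^ 2 ≤ 1 := by
          have := abs_real_inner_le_norm v v'
          rw [hv, hv', mul_one] at this
          rw [← sq_abs]
          exact pow_le_one₀ (abs_nonneg _) this
        nlinarith [sq_nonneg ⟪v, v'⟫, sq_nonneg (κ ^ 2)]

/-- Apply `exp y ≥ 1 + y` under the average over `g`: the linear term has mean zero, so the bound is
uniform in `x`. -/
lemma ofReal_le_spikeDensity (κ : ℝ) (v x : EuclideanSpace ℝ ι) :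
    ENNReal.ofReal (1 - κ ^ 2 / 2) ≤ spikeDensity κ v x := by
  have hm : MemLp id 2 (gaussianReal 0 1) := IsGaussian.memLp_two_id
  have hi : Integrable (fun g : ℝ => g) (gaussianReal 0 1) := hm.integrable one_le_two
  have hi2 : Integrable (fun g : ℝ => g ^ 2) (gaussianReal 0 1) := hm.integrable_sq
  have h2 : ∫ g, g ^ 2 ∂gaussianReal 0 1 = 1 := by
    have := variance_id_gaussianReal (μ := 0) (v := 1)
    rw [variance_of_integral_eq_zero (by fun_prop) (by simp)] at this
    simpa using this
  set F : ℝ → ℝ := fun g => (1 + (κ * ⟪v, x⟫) * g) - κ ^ 2 / 2 * g ^ 2 with hF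
  have hFi : Integrable F (gaussianReal 0 1) :=
    ((integrable_const 1).add (hi.const_mul _)).sub (hi2.const_mul _)
  have hint : ∫ g, F g ∂gaussianReal 0 1 = 1 - κ ^ 2 / 2 := by
    simp only [hF]
    have hi1 : Integrable (fun g : ℝ => 1 + (κ * ⟪v, x⟫) * g) (gaussianReal 0 1) :=
      (integrable_const 1).add (hi.const_mul _)
    rw [integral_sub hi1 (hi2.const_mul _),
      integral_add (integrable_const 1) (hi.const_mul _), integral_const_mul, integral_const_mul, h2]
    simp
  calc ENNReal.ofReal (1 - κ ^ 2 / 2) = ENNReal.ofReal (∫ g, F g ∂gaussianReal 0 1) := by rw [hint]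
    -- `F` may be negative; its positive part is still below the exponential and can be passed to a
    -- lower integral.
    _ ≤ ENNReal.ofReal (∫ g, max (F g) 0 ∂gaussianReal 0 1) :=
        ENNReal.ofReal_le_ofReal (integral_mono hFi hFi.pos_part fun g => le_max_left _ _)
    _ = ∫⁻ g, ENNReal.ofReal (max (F g) 0) ∂gaussianReal 0 1 :=
        ofReal_integral_eq_lintegral_ofReal hFi.pos_part
          (Filter.Eventually.of_forall fun _ => le_max_right _ _)
    _ ≤ _ := by
        refine lintegral_mono fun g => ENNReal.ofReal_le_ofReal ?_
        refine max_le ?_ (Real.exp_pos _).le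
        refine le_trans (le_of_eq ?_) (Real.add_one_le_exp _)
        simp only [hF]
        ring

end

/-! ### Testing a point against a mixture -/

lemma le_sq_div_add {K : ℝ} (hK : 0 < K) (y : ℝ≥0∞) :
    y ≤ ENNReal.ofReal (1 / (4 * K)) * y ^ 2 + ENNReal.ofReal K := by
  rcases eq_or_ne y ∞ with rfl | hy
  · have : ENNReal.ofReal (1 / (4 * K)) ≠ 0 := by
      rw [ne_eq, ENNReal.ofReal_eq_zero, not_le]; positivity
    rw [ENNReal.top_pow two_ne_zero, ENNReal.mul_top this, top_add]
  · lift y to NNReal using hy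
    rw [← ENNReal.ofReal_coe_nnreal, ← ENNReal.ofReal_pow y.coe_nonneg,
      ← ENNReal.ofReal_mul (by positivity), ← ENNReal.ofReal_add (by positivity) hK.le]
    refine ENNReal.ofReal_le_ofReal ?_
    have : 1 / (4 * K) * (y : ℝ) ^ 2 + K - y = (1 / (4 * K)) * (y - 2 * K) ^ 2 := by
      field_simp; ring
    nlinarith [show 0 ≤ (1 / (4 * K)) * ((y : ℝ) - 2 * K) ^ 2 by positivity]

/-- Le Cam's method: if the likelihood ratio of a uniform mixture has second moment at most `K`,
then the point and the mixture cannot be told apart. -/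
lemma exists_half_le_of_second_moment {Ω I : Type*} [MeasurableSpace Ω] [Fintype I] [Nonempty I]
    (μ : Measure Ω) (f : I → Ω → ℝ≥0∞) (hf : ∀ i, Measurable (f i))
    (hprob : ∀ i, IsProbabilityMeasure (μ.withDensity (f i))) {K : ℝ} (hK : 0 < K)
    (hsec : ∑ i, ∑ j, ∫⁻ x, f i x * f j x ∂μ ≤ ENNReal.ofReal K * (Fintype.card I : ℝ≥0∞) ^ 2)
    {E : Set Ω} (hE : MeasurableSet E) (hμE : μ Eᶜ < ENNReal.ofReal (1 / (4 * K))) :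
    ∃ i, ENNReal.ofReal (1 / 2) ≤ μ.withDensity (f i) E := by
  by_contra! hcon
  set N : ℝ≥0∞ := (Fintype.card I : ℝ≥0∞) with hN
  have hN0 : N ≠ 0 := by simp [hN]
  have hNt : N ≠ ∞ := by simp [hN]
  have hlow : ∀ i, ENNReal.ofReal (1 / 2) < μ.withDensity (f i) Eᶜ := by
    intro i
    have hp := hprob i
    have hadd := prob_add_prob_compl (μ := μ.withDensity (f i)) hE
    by_contra! hle
    have := ENNReal.add_lt_add_of_lt_of_le (by finiteness) (hcon i) hle
    rw [hadd, ← ENNReal.ofReal_add (by norm_num) (by norm_num)] at this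
    norm_num at this
  have hsum : N * ENNReal.ofReal (1 / 2) < ∑ i, μ.withDensity (f i) Eᶜ := by
    have : N * ENNReal.ofReal (1 / 2) = ∑ _i : I, ENNReal.ofReal (1 / 2) := by
      simp [hN]
    rw [this]
    exact ENNReal.sum_lt_sum_of_nonempty Finset.univ_nonempty fun i _ => hlow i
  set S : Ω → ℝ≥0∞ := fun x => ∑ i, f i x with hS
  have hSm : Measurable S := Finset.measurable_sum _ fun i _ => hf i
  have heq : ∑ i, μ.withDensity (f i) Eᶜ = N * ∫⁻ x in Eᶜ, N⁻¹ * S x ∂μ := by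
    rw [lintegral_const_mul _ hSm, ← mul_assoc, ENNReal.mul_inv_cancel hN0 hNt, one_mul, hS,
      lintegral_finsetSum _ fun i _ => hf i]
    exact Finset.sum_congr rfl fun i _ => withDensity_apply _ hE.compl
  have hsq : ∫⁻ x, (N⁻¹ * S x) ^ 2 ∂μ ≤ ENNReal.ofReal K := by
    have h1 : ∀ x, (N⁻¹ * S x) ^ 2 = N⁻¹ ^ 2 * ∑ i, ∑ j, f i x * f j x := by
      intro x
      rw [mul_pow, sq (S x), hS, Finset.sum_mul_sum]
    simp_rw [h1]
    have hm : ∀ i j, Measurable fun x => f i x * f j x := fun i j => (hf i).mul (hf j)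
    rw [lintegral_const_mul _ (by fun_prop), lintegral_finsetSum _ fun i _ => by fun_prop]
    have h2 : ∀ i, ∫⁻ x, ∑ j, f i x * f j x ∂μ = ∑ j, ∫⁻ x, f i x * f j x ∂μ := fun i =>
      lintegral_finsetSum _ fun j _ => hm i j
    simp_rw [h2]
    calc _ ≤ N⁻¹ ^ 2 * (ENNReal.ofReal K * N ^ 2) := by gcongr
      _ = ENNReal.ofReal K * (N⁻¹ * N) ^ 2 := by ring
      _ = ENNReal.ofReal K := by rw [ENNReal.inv_mul_cancel hN0 hNt]; simp
  -- With `L` the mixture likelihood ratio, `L ≤ L²/(4K) + K`; the two terms contribute at most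
  -- `1/4` each.
  have hup : ∫⁻ x in Eᶜ, N⁻¹ * S x ∂μ ≤ ENNReal.ofReal (1 / 2) := by
    calc ∫⁻ x in Eᶜ, N⁻¹ * S x ∂μ
        ≤ ∫⁻ x in Eᶜ, ENNReal.ofReal (1 / (4 * K)) * (N⁻¹ * S x) ^ 2 + ENNReal.ofReal K ∂μ :=
          lintegral_mono fun x => le_sq_div_add hK _
      _ = ENNReal.ofReal (1 / (4 * K)) * ∫⁻ x in Eᶜ, (N⁻¹ * S x) ^ 2 ∂μ +
          ENNReal.ofReal K * μ Eᶜ := by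
          rw [lintegral_add_right _ measurable_const, lintegral_const_mul _ (by fun_prop)]
          simp
      _ ≤ ENNReal.ofReal (1 / (4 * K)) * ENNReal.ofReal K +
          ENNReal.ofReal K * ENNReal.ofReal (1 / (4 * K)) := by
          gcongr
          exact (setLIntegral_le_lintegral _ _).trans hsq
      _ = ENNReal.ofReal (1 / 2) := by
          rw [← ENNReal.ofReal_mul (by positivity), ← ENNReal.ofReal_mul hK.le,
            ← ENNReal.ofReal_add (by positivity) (by positivity)]
          congr 1
          field_simp
          norm_num
  rw [heq] at hsum
  exact absurd hsum (not_lt.2 (by gcongr))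

/-! ### The overlap of random signed block vectors -/

/-- Use `cosh x - 1 = 2 sinh²(x/2)` and `sinh y ≤ y exp y`. -/
lemma cosh_sub_one_le {x : ℝ} (hx : 0 ≤ x) : Real.cosh x - 1 ≤ x ^ 2 / 2 * Real.exp x := by
  have h1 : Real.cosh x - 1 = 2 * Real.sinh (x / 2) ^ 2 := by
    have h := Real.cosh_two_mul (x / 2)
    have h' := Real.cosh_sq (x / 2)
    rw [show 2 * (x / 2) = x by ring] at h
    linarith
  have h2 : Real.sinh (x / 2) ≤ x / 2 * Real.exp (x / 2) := by
    rw [Real.sinh_eq]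
    have h3 := Real.add_one_le_exp (-x)
    have h4 : Real.exp (-(x / 2)) = Real.exp (-x) * Real.exp (x / 2) := by
      rw [← Real.exp_add]; ring_nf
    rw [h4]
    nlinarith [Real.exp_pos (x / 2)]
  have h5 : 0 ≤ Real.sinh (x / 2) := Real.sinh_nonneg_iff.2 (by linarith)
  have h6 : Real.exp x = Real.exp (x / 2) ^ 2 := by
    rw [← Real.exp_nat_mul]; congr 1; push_cast; ring
  rw [h1, h6]
  have := pow_le_pow_left₀ h5 h2 2
  nlinarith

/-- The sign `±1` encoded by a Boolean. -/
def boolSign (b : Bool) : ℝ := if b then 1 else -1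

lemma boolSign_mul_self (b : Bool) : boolSign b * boolSign b = 1 := by
  cases b <;> simp [boolSign]

/-- The inner product of two signed basis vectors. -/
def signedMatch {m : ℕ} (a b : Fin m × Bool) : ℝ :=
  if a.1 = b.1 then boolSign a.2 * boolSign b.2 else 0

/-- The unnormalised inner product of two block-wise signed basis vectors. -/
def overlap {s m : ℕ} (ω ω' : Fin s → Fin m × Bool) : ℝ := ∑ b, signedMatch (ω b) (ω' b)

lemma abs_signedMatch_le {m : ℕ} (a b : Fin m × Bool) : |signedMatch a b| ≤ 1 := by
  obtain ⟨j, σ⟩ := a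
  obtain ⟨j', σ'⟩ := b
  unfold signedMatch boolSign
  split_ifs <;> simp

lemma abs_overlap_le {s m : ℕ} (ω ω' : Fin s → Fin m × Bool) : |overlap ω ω'| ≤ s := by
  refine (Finset.abs_sum_le_sum_abs _ _).trans ?_
  refine (Finset.sum_le_sum fun b _ => abs_signedMatch_le (ω b) (ω' b)).trans ?_
  simp

lemma sum_exp_signedMatch {m : ℕ} (x : ℝ) (a : Fin m × Bool) :
    ∑ b, Real.exp (x * signedMatch a b) = 2 * m + 2 * (Real.cosh x - 1) := by
  have h : ∀ j : Fin m, ∑ τ, Real.exp (x * signedMatch a (j, τ)) =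
      2 + if a.1 = j then 2 * (Real.cosh x - 1) else 0 := by
    intro j
    obtain ⟨i, σ⟩ := a
    by_cases hij : i = j
    · subst hij
      cases σ <;> simp [signedMatch, boolSign, Real.cosh_eq] <;> ring
    · simp [signedMatch, hij]
  rw [Fintype.sum_prod_type]
  simp_rw [h]
  rw [Finset.sum_add_distrib]
  simp [mul_comm]

/-- The blocks are chosen independently, so the sum factorises over them. This is the benefit of
block vectors over arbitrary `s`-subsets. -/
lemma sum_exp_overlap_le {s m : ℕ} (hm : 0 < m) {x : ℝ} (hx : 0 ≤ x)
    (ω : Fin s → Fin m × Bool) {y : ℝ} (hy : |y| = x) :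
    ∑ ω' : Fin s → Fin m × Bool, Real.exp (y * overlap ω ω') ≤
      (2 * m) ^ s * Real.exp (s * (x ^ 2 / 2 * Real.exp x / m)) := by
  have hm' : (0 : ℝ) < m := by exact_mod_cast hm
  have h1 : ∑ ω' : Fin s → Fin m × Bool, Real.exp (y * overlap ω ω') =
      ∏ b, ∑ c, Real.exp (y * signedMatch (ω b) c) := by
    rw [Finset.prod_univ_sum, Fintype.piFinset_univ]
    refine Finset.sum_congr rfl fun ω' _ => ?_
    rw [overlap, Finset.mul_sum, Real.exp_sum]
  rw [h1]
  simp_rw [sum_exp_signedMatch]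
  rw [Finset.prod_const, Finset.card_univ, Fintype.card_fin, Real.exp_nat_mul, ← mul_pow]
  have hc : Real.cosh y = Real.cosh x := by rw [← hy, Real.cosh_abs]
  have h0 : 1 ≤ Real.cosh y := Real.one_le_cosh y
  refine pow_le_pow_left₀ (by nlinarith) ?_ s
  have h2 := Real.add_one_le_exp (x ^ 2 / 2 * Real.exp x / m)
  have h3 := cosh_sub_one_le hx
  rw [hc]
  calc 2 * (m : ℝ) + 2 * (Real.cosh x - 1) ≤ 2 * m + 2 * (x ^ 2 / 2 * Real.exp x) := by linarith
    _ = 2 * m * (x ^ 2 / 2 * Real.exp x / m + 1) := by field_simp; ring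
    _ ≤ _ := by gcongr

/-- With `u = log(e m)`, one has `m = exp(u - 1)`, while the numerator is at most `exp(u/2 - 1 +
u/8)`. -/
lemma mul_exp_le_of_le_log {m : ℕ} (hm : 0 < m) {t : ℝ} (ht0 : 0 ≤ t)
    (ht : t ≤ Real.log (Real.exp 1 * m) / 32) : 8 * t * Real.exp (4 * t) / m ≤ 1 := by
  have hm' : (0 : ℝ) < m := by exact_mod_cast hm
  have hu : Real.exp (Real.log (Real.exp 1 * m) - 1) = m := by
    rw [Real.exp_sub, Real.exp_log (by positivity)]
    field_simp
  set u := Real.log (Real.exp 1 * m)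
  rw [div_le_one hm', ← hu]
  have h1 : u / 2 ≤ Real.exp (u / 2 - 1) := by linarith [Real.add_one_le_exp (u / 2 - 1)]
  have h2 : Real.exp (4 * t) ≤ Real.exp (u / 8) := Real.exp_le_exp.2 (by linarith)
  calc 8 * t * Real.exp (4 * t) ≤ (u / 2) * Real.exp (u / 8) := by
        exact mul_le_mul (by linarith) h2 (Real.exp_pos _).le (by linarith)
    _ ≤ Real.exp (u / 2 - 1) * Real.exp (u / 8) := by gcongr
    _ = Real.exp (u / 2 - 1 + u / 8) := by rw [Real.exp_add]
    _ ≤ Real.exp (u - 1) := Real.exp_le_exp.2 (by linarith)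

/-- The exponential moment of the squared overlap with a uniformly random signed block vector. -/
lemma sum_exp_overlap_sq_le {s m : ℕ} (hs : 0 < s) (hm : 0 < m) {t : ℝ} (ht0 : 0 ≤ t)
    (ht : t ≤ Real.log (Real.exp 1 * m) / 32) (ω : Fin s → Fin m × Bool) :
    ∑ ω' : Fin s → Fin m × Bool, Real.exp (t * overlap ω ω' ^ 2 / s) ≤ 12 * (2 * m) ^ s := by
  have hm' : (0 : ℝ) < m := by exact_mod_cast hm
  have hs' : (0 : ℝ) < s := by exact_mod_cast hs
  -- Peeling: with `R` the overlap and `W = t R²/s`, on the level `k ≤ W < k + 1` this choice gives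
  -- `x k * |R| ≥ 4k`, hence `exp W ≤ exp(1 - 3k) exp(x k * |R|)`. The moment generating function at
  -- `± x k` costs only a factor `exp k`, so the levels sum geometrically.
  set x : ℕ → ℝ := fun k => 4 * √(t * k / s) with hx
  have hx0 : ∀ k, 0 ≤ x k := fun k => by positivity
  set n := ⌊t * s⌋₊ + 1 with hn
  have hpt : ∀ ω' : Fin s → Fin m × Bool, Real.exp (t * overlap ω ω' ^ 2 / s) ≤
      ∑ k ∈ Finset.range n, Real.exp (1 - 3 * k) *
        (Real.exp (x k * overlap ω ω') + Real.exp (-x k * overlap ω ω')) := by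
    intro ω'
    set R := overlap ω ω'
    set W := t * R ^ 2 / s with hW
    have hW0 : 0 ≤ W := by positivity
    set k := ⌊W⌋₊ with hk
    have hkW : (k : ℝ) ≤ W := Nat.floor_le hW0
    have hWk : W < k + 1 := Nat.lt_floor_add_one W
    have hR : R ^ 2 ≤ s ^ 2 := sq_le_sq.2 ((abs_overlap_le ω ω').trans (le_abs_self _))
    have hWs : W ≤ t * s := by
      rw [hW, div_le_iff₀ hs']
      nlinarith
    have hmem : k ∈ Finset.range n := by
      rw [Finset.mem_range, hn, Nat.lt_succ_iff]
      exact Nat.floor_le_floor hWs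
    have hkx : 4 * (k : ℝ) ≤ x k * |R| := by
      have : (k : ℝ) ≤ √(t * k / s) * |R| := by
        rw [← Real.sqrt_sq_eq_abs, ← Real.sqrt_mul (by positivity)]
        refine Real.le_sqrt_of_sq_le ?_
        calc (k : ℝ) ^ 2 = k * k := sq _
          _ ≤ k * W := by gcongr
          _ = t * k / s * R ^ 2 := by rw [hW]; ring
      simp only [hx]
      linarith
    have habs : Real.exp (x k * |R|) ≤ Real.exp (x k * R) + Real.exp (-x k * R) := by
      rcases abs_cases R with ⟨h, _⟩ | ⟨h, _⟩
      · rw [h]; linarith [Real.exp_pos (-x k * R)]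
      · rw [h, mul_neg, ← neg_mul]; linarith [Real.exp_pos (x k * R)]
    refine le_trans ?_ (Finset.single_le_sum (f := fun k : ℕ => Real.exp (1 - 3 * k) *
        (Real.exp (x k * R) + Real.exp (-x k * R))) (fun _ _ => by positivity) hmem)
    calc Real.exp W ≤ Real.exp ((1 - 3 * k) + x k * |R|) := Real.exp_le_exp.2 (by linarith)
      _ = Real.exp (1 - 3 * k) * Real.exp (x k * |R|) := Real.exp_add _ _
      _ ≤ _ := by gcongr
  have hmgf : ∀ k ∈ Finset.range n, ∀ y : ℝ, |y| = x k →
      ∑ ω' : Fin s → Fin m × Bool, Real.exp (y * overlap ω ω') ≤ (2 * m) ^ s * Real.exp k := by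
    intro k hk y hy
    have hk' : (k : ℝ) ≤ t * s := by
      rw [Finset.mem_range, hn, Nat.lt_succ_iff] at hk
      exact (Nat.cast_le.2 hk).trans (Nat.floor_le (by positivity))
    refine (sum_exp_overlap_le hm (hx0 k) ω hy).trans ?_
    gcongr
    have hxt : x k ≤ 4 * t := by
      have : √(t * k / s) ≤ t := by
        refine Real.sqrt_le_iff.2 ⟨ht0, ?_⟩
        rw [div_le_iff₀ hs']
        nlinarith
      simp only [hx]; linarith
    have hx2 : x k ^ 2 = 16 * (t * k / s) := by
      simp only [hx]
      rw [mul_pow, Real.sq_sqrt (by positivity)]; norm_num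
    calc (s : ℝ) * (x k ^ 2 / 2 * Real.exp (x k) / m)
        = k * (8 * t * Real.exp (x k) / m) := by rw [hx2]; field_simp; ring
      _ ≤ k * (8 * t * Real.exp (4 * t) / m) := by gcongr
      _ ≤ k * 1 := by gcongr; exact mul_exp_le_of_le_log hm ht0 ht
      _ = k := mul_one _
  have hgeom : ∑ k ∈ Finset.range n, Real.exp (-2) ^ k ≤ 2 := by
    have h1 : Real.exp (-2) ≤ 1 / 2 := by
      rw [Real.exp_neg, inv_le_comm₀ (Real.exp_pos _) (by norm_num)]
      linarith [Real.add_one_le_exp (2 : ℝ)]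
    calc ∑ k ∈ Finset.range n, Real.exp (-2) ^ k ≤ ∑ k ∈ Finset.range n, (1 / 2 : ℝ) ^ k := by
          gcongr
      _ ≤ 2 := sum_geometric_two_le n
  calc ∑ ω' : Fin s → Fin m × Bool, Real.exp (t * overlap ω ω' ^ 2 / s)
      ≤ ∑ ω' : Fin s → Fin m × Bool, ∑ k ∈ Finset.range n, Real.exp (1 - 3 * k) *
        (Real.exp (x k * overlap ω ω') + Real.exp (-x k * overlap ω ω')) :=
        Finset.sum_le_sum fun ω' _ => hpt ω'
    _ = ∑ k ∈ Finset.range n, Real.exp (1 - 3 * k) *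
        (∑ ω' : Fin s → Fin m × Bool, Real.exp (x k * overlap ω ω') +
          ∑ ω' : Fin s → Fin m × Bool, Real.exp (-x k * overlap ω ω')) := by
        rw [Finset.sum_comm]
        refine Finset.sum_congr rfl fun k _ => ?_
        rw [← Finset.sum_add_distrib, Finset.mul_sum]
    _ ≤ ∑ k ∈ Finset.range n, Real.exp (1 - 3 * k) *
        ((2 * m) ^ s * Real.exp k + (2 * m) ^ s * Real.exp k) := by
        refine Finset.sum_le_sum fun k hk => ?_
        gcongr
        · exact hmgf k hk _ (abs_of_nonneg (hx0 k))
        · exact hmgf k hk _ (by rw [abs_neg, abs_of_nonneg (hx0 k)])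
    _ = 2 * Real.exp 1 * (2 * m) ^ s * ∑ k ∈ Finset.range n, Real.exp (-2) ^ k := by
        rw [Finset.mul_sum]
        refine Finset.sum_congr rfl fun k _ => ?_
        rw [← Real.exp_nat_mul]
        have : Real.exp 1 * Real.exp (k * (-2 : ℝ)) = Real.exp (1 - 3 * k) * Real.exp k := by
          rw [← Real.exp_add, ← Real.exp_add]; ring_nf
        linear_combination (-2 * (2 * (m : ℝ)) ^ s) * this
    _ ≤ 2 * Real.exp 1 * (2 * m) ^ s * 2 := by gcongr
    -- The constant is `4e < 12`.
    _ ≤ 12 * (2 * m) ^ s := by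
        have : Real.exp 1 < 3 := Real.exp_one_lt_three
        nlinarith [show (0 : ℝ) < (2 * m) ^ s by positivity]

/-! ### Signed block vectors -/

/-- The unit vector with one signed coordinate in each of `s` blocks. -/
noncomputable def blockVector {p s m : ℕ} (e : Fin s × Fin m → Fin p) (ω : Fin s → Fin m × Bool) :
    EuclideanSpace ℝ (Fin p) :=
  (√s)⁻¹ • ∑ b, boolSign (ω b).2 • EuclideanSpace.single (e (b, (ω b).1)) (1 : ℝ)

/-- Injectivity of `e` makes different blocks orthogonal, so only equal block indices contribute. -/
lemma inner_blockVector {p s m : ℕ} {e : Fin s × Fin m → Fin p} (he : Function.Injective e)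
    (ω ω' : Fin s → Fin m × Bool) :
    ⟪blockVector e ω, blockVector e ω'⟫ = overlap ω ω' / s := by
  have hs : ((√s)⁻¹ : ℝ) * (√s)⁻¹ = (s : ℝ)⁻¹ := by
    rw [← mul_inv, Real.mul_self_sqrt (Nat.cast_nonneg s)]
  rw [blockVector, blockVector, real_inner_smul_left, real_inner_smul_right, ← mul_assoc, hs,
    sum_inner, overlap, div_eq_inv_mul]
  congr 1
  refine Finset.sum_congr rfl fun b _ => ?_
  rw [inner_sum, Finset.sum_eq_single b]
  · simp only [real_inner_smul_left, real_inner_smul_right, signedMatch]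
    by_cases h : (ω b).1 = (ω' b).1
    · simp [h, mul_comm]
    · have : e (b, (ω b).1) ≠ e (b, (ω' b).1) := fun h' => h (by simpa using he h')
      simp [h, EuclideanSpace.inner_single_left, this]
  · intro c _ hc
    have : e (b, (ω b).1) ≠ e (c, (ω' c).1) := fun h' => hc (by simpa using (congrArg Prod.fst (he h')).symm)
    simp [real_inner_smul_left, real_inner_smul_right, EuclideanSpace.inner_single_left, this]
  · simp

lemma overlap_self {s m : ℕ} (ω : Fin s → Fin m × Bool) : overlap ω ω = s := by
  simp [overlap, signedMatch, boolSign_mul_self]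

lemma norm_blockVector {p s m : ℕ} (hs : 0 < s) {e : Fin s × Fin m → Fin p}
    (he : Function.Injective e) (ω : Fin s → Fin m × Bool) : ‖blockVector e ω‖ = 1 := by
  have h := inner_blockVector he ω ω
  rw [overlap_self, div_self (by exact_mod_cast hs.ne'), real_inner_self_eq_norm_sq] at h
  exact (pow_eq_one_iff_of_nonneg (norm_nonneg _) two_ne_zero).1 h

lemma blockVector_apply_eq_zero {p s m : ℕ} (e : Fin s × Fin m → Fin p)
    (ω : Fin s → Fin m × Bool) {i : Fin p}
    (hi : i ∉ Finset.univ.image fun b => e (b, (ω b).1)) : blockVector e ω i = 0 := by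
  have : ∀ b, i ≠ e (b, (ω b).1) := fun b hb => hi (Finset.mem_image.2 ⟨b, Finset.mem_univ b, hb.symm⟩)
  simp [blockVector, this]

lemma exists_injective_prod {p s m : ℕ} (h : s * m ≤ p) :
    ∃ e : Fin s × Fin m → Fin p, Function.Injective e :=
  ⟨fun q => Fin.castLE h (finProdFinEquiv q),
    (Fin.castLE_injective h).comp finProdFinEquiv.injective⟩

/-! ### The operator norm -/

lemma opNorm_sub_le {p : ℕ} (T A B : Matrix (Fin p) (Fin p) ℝ) :
    opNorm (B - A) ≤ opNorm (T - A) + opNorm (T - B) := by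
  unfold opNorm
  rw [show B - A = (T - A) - (T - B) by abel, map_sub]
  exact norm_sub_le _ _

lemma continuous_opNorm {p : ℕ} : Continuous (opNorm : Matrix (Fin p) (Fin p) ℝ → ℝ) := by
  unfold opNorm
  refine continuous_norm.comp ?_
  exact LinearMap.continuous_of_finiteDimensional
    (Matrix.toEuclideanCLM (n := Fin p) (𝕜 := ℝ)).toAlgEquiv.toLinearMap

lemma measurable_opNorm_sub {n p : ℕ}
    {T : (Fin n → EuclideanSpace ℝ (Fin p)) → Matrix (Fin p) (Fin p) ℝ} (hT : IsEstimator T)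
    (A : Matrix (Fin p) (Fin p) ℝ) : Measurable fun X => opNorm (T X - A) := by
  borelize (Matrix (Fin p) (Fin p) ℝ)
  have h : Measurable fun X => (fun i j => T X i j : Fin p → Fin p → ℝ) :=
    measurable_pi_lambda _ fun i => measurable_pi_lambda _ fun j => hT i j
  have hc : Continuous fun B : Fin p → Fin p → ℝ => opNorm (Matrix.of B - A) :=
    continuous_opNorm.comp (Continuous.sub continuous_id continuous_const)
  exact hc.measurable.comp h

lemma toEuclideanCLM_spikeMatrix {p : ℕ} (a κ : ℝ) (v x : EuclideanSpace ℝ (Fin p)) :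
    Matrix.toEuclideanCLM (n := Fin p) (𝕜 := ℝ) (spikeMatrix a κ v) x =
      a • (x + (κ ^ 2 * ⟪v, x⟫) • v) := by
  have h3 : (v : Fin p → ℝ) ⬝ᵥ x = ⟪v, x⟫ := by
    simp [PiLp.inner_apply, dotProduct, mul_comm]
  ext i
  simp only [spikeMatrix, map_smul, map_add, map_one, _root_.smul_apply,
    _root_.add_apply, one_apply_eq_self, Matrix.ofLp_toEuclideanCLM,
    Matrix.vecMulVec_mulVec, h3, PiLp.smul_apply, PiLp.add_apply, Pi.smul_apply, smul_eq_mul,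
    op_smul_eq_smul]
  ring

lemma opNorm_spikeMatrix_le {p : ℕ} {a : ℝ} (ha : 0 ≤ a) (κ : ℝ) {v : EuclideanSpace ℝ (Fin p)}
    (hv : ‖v‖ = 1) : opNorm (spikeMatrix a κ v) ≤ a * (1 + κ ^ 2) := by
  refine ContinuousLinearMap.opNorm_le_bound _ (by positivity) fun x => ?_
  rw [toEuclideanCLM_spikeMatrix, norm_smul, Real.norm_eq_abs, abs_of_nonneg ha, mul_assoc]
  gcongr
  refine (norm_add_le _ _).trans ?_
  rw [norm_smul, hv, mul_one, Real.norm_eq_abs, abs_mul, abs_of_nonneg (sq_nonneg κ), add_mul, one_mul]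
  gcongr
  simpa [hv] using abs_real_inner_le_norm v x

/-- The difference maps `v` to `a κ² v`. Strength zero erases `w`, so one null matrix serves for all
spikes. -/
lemma le_opNorm_spikeMatrix_sub {p : ℕ} {a : ℝ} (κ : ℝ)
    {v : EuclideanSpace ℝ (Fin p)} (hv : ‖v‖ = 1) (w : EuclideanSpace ℝ (Fin p)) :
    a * κ ^ 2 ≤ opNorm (spikeMatrix a κ v - spikeMatrix a 0 w) := by
  have h := (Matrix.toEuclideanCLM (n := Fin p) (𝕜 := ℝ)
    (spikeMatrix a κ v - spikeMatrix a 0 w)).le_opNorm v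
  rw [map_sub, _root_.sub_apply, toEuclideanCLM_spikeMatrix,
    toEuclideanCLM_spikeMatrix, hv, mul_one, ← map_sub] at h
  rw [real_inner_self_eq_norm_sq, hv, ← smul_sub] at h
  simp only [one_pow, mul_one, ne_eq, OfNat.ofNat_ne_zero, not_false_eq_true, zero_pow, zero_mul,
    zero_smul, add_zero, add_sub_cancel_left, norm_smul, hv, Real.norm_eq_abs] at h
  refine le_trans ?_ h
  rw [abs_of_nonneg (sq_nonneg κ)]
  gcongr
  exact le_abs_self a

lemma spikeMatrix_mem {p s : ℕ} {M κ : ℝ} (hM : 0 < M) (hκ : κ ^ 2 ≤ 1)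
    {v : EuclideanSpace ℝ (Fin p)} (hv : ‖v‖ = 1) {S : Finset (Fin p)} (hS : S.card ≤ s)
    (hvS : ∀ i, i ∉ S → v i = 0) :
    spikeMatrix (M / 2) κ v ∈ sparseClass p s ∩ boundedClass p M := by
  have hpos := spikeMatrix_posSemidef (half_pos hM).le κ v
  refine ⟨⟨hpos, S, hS, fun i j hij => ?_⟩, hpos, ?_⟩
  · rcases eq_or_ne i j with rfl | hne
    · simp
    · have hz : v i * v j = 0 := by
        rcases hij with h | h <;> simp [hvS _ h]
      simp [spikeMatrix, Matrix.vecMulVec_apply, hne, hz]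
  · refine (opNorm_spikeMatrix_le (half_pos hM).le κ hv).trans ?_
    nlinarith

/-! ### Contamination -/

/-- This choice of `Q` makes the sparse lower bound valid at every contamination level. -/
lemma contaminated_self {p : ℕ} {ε : ℝ} (h0 : 0 ≤ ε) (h1 : ε ≤ 1) (A : Matrix (Fin p) (Fin p) ℝ) :
    contaminated ε A (multivariateGaussian 0 A) = multivariateGaussian 0 A := by
  rw [contaminated, ← add_smul, ← ENNReal.ofReal_add (by linarith) h0]
  simp

/-- A contamination of the null model that reproduces a contamination of the spiked model. -/
lemma exists_contaminated_eq {p : ℕ} {ε a : ℝ} (ha : 0 < a) (h0 : 0 < ε) (h1 : ε ≤ 1)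
    {v : EuclideanSpace ℝ (Fin p)} (hv : ‖v‖ = 1) :
    ∃ Q : ProbabilityMeasure (EuclideanSpace ℝ (Fin p)),
      contaminated ε (spikeMatrix a 0 v) Q =
        contaminated ε (spikeMatrix a (√ε) v) (multivariateGaussian 0 (spikeMatrix a 0 v)) := by
  set P₀ := multivariateGaussian 0 (spikeMatrix a 0 v) with hP₀
  set P₁ := multivariateGaussian 0 (spikeMatrix a (√ε) v) with hP₁
  have hle : ENNReal.ofReal (1 - ε / 2) • P₀ ≤ P₁ := by
    rw [hP₀, hP₁, multivariateGaussian_spikeMatrix ha (√ε) v hv, ← stdGaussian_map_smul_eq ha,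
      ← withDensity_const]
    refine withDensity_mono (Filter.Eventually.of_forall fun x => ?_)
    have := ofReal_le_spikeDensity (√ε) v ((√a)⁻¹ • x)
    rwa [Real.sq_sqrt h0.le] at this
  set μ := contaminated ε (spikeMatrix a (√ε) v) P₀ with hμ
  have hμ1 : μ Set.univ = 1 := by
    simp only [hμ, contaminated, Measure.coe_add, Measure.coe_smul, Pi.add_apply, Pi.smul_apply,
      measure_univ, smul_eq_mul, mul_one]
    rw [← ENNReal.ofReal_add (by linarith) h0.le]
    simp
  -- The mixture contains at least `(1 - ε)(1 - ε/2) + ε` copies of `P₀`; after removing `1 - ε` of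
  -- them, the remainder, of mass `ε`, is normalised to give `Q`.
  have hle2 : ENNReal.ofReal (1 - ε) • P₀ ≤ μ := by
    calc ENNReal.ofReal (1 - ε) • P₀
        ≤ ENNReal.ofReal ((1 - ε) * (1 - ε / 2) + ε) • P₀ := by
          refine Measure.le_iff.2 fun s _ => ?_
          simp only [Measure.smul_apply, smul_eq_mul]
          gcongr
          nlinarith
      _ = ENNReal.ofReal (1 - ε) • ENNReal.ofReal (1 - ε / 2) • P₀ + ENNReal.ofReal ε • P₀ := by
          rw [ENNReal.ofReal_add (by nlinarith) h0.le, ENNReal.ofReal_mul (by linarith), add_smul,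
            smul_smul]
      _ ≤ μ := by
          refine Measure.le_iff.2 fun s _ => ?_
          have := hle s
          simp only [hμ, contaminated, Measure.coe_add, Measure.coe_smul, Pi.add_apply,
            Pi.smul_apply] at this ⊢
          gcongr
  have hfin : IsFiniteMeasure (ENNReal.ofReal (1 - ε) • P₀) := by
    constructor
    simp only [Measure.smul_apply, measure_univ, smul_eq_mul, mul_one]
    exact ENNReal.ofReal_lt_top
  set D := μ - ENNReal.ofReal (1 - ε) • P₀ with hD
  have hadd : D + ENNReal.ofReal (1 - ε) • P₀ = μ := Measure.sub_add_cancel_of_le hle2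
  have hε0 : ENNReal.ofReal ε ≠ 0 := by simpa using h0
  have hDu : D Set.univ = ENNReal.ofReal ε := by
    have h := congrArg (fun ν : Measure _ => ν Set.univ) hadd
    simp only [Measure.coe_add, Measure.coe_smul, Pi.add_apply, Pi.smul_apply, measure_univ,
      smul_eq_mul, mul_one, hμ1] at h
    have h2 : ENNReal.ofReal ε + ENNReal.ofReal (1 - ε) = 1 := by
      rw [← ENNReal.ofReal_add h0.le (by linarith)]; simp
    exact (ENNReal.add_left_inj ENNReal.ofReal_ne_top).1 (h.trans h2.symm)
  have hprob : IsProbabilityMeasure ((ENNReal.ofReal ε)⁻¹ • D) := by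
    constructor
    rw [Measure.smul_apply, hDu, smul_eq_mul, ENNReal.inv_mul_cancel hε0 ENNReal.ofReal_ne_top]
  refine ⟨⟨(ENNReal.ofReal ε)⁻¹ • D, hprob⟩, ?_⟩
  rw [contaminated, ProbabilityMeasure.coe_mk, smul_smul,
    ENNReal.mul_inv_cancel hε0 ENNReal.ofReal_ne_top, one_smul, add_comm]
  exact hadd

/-! ### Lower bounds -/

lemma le_minimaxProb {n p : ℕ} {Θ : Set (Matrix (Fin p) (Fin p) ℝ)} {ε r : ℝ} {c : ℝ≥0∞}
    (h : ∀ T : (Fin n → EuclideanSpace ℝ (Fin p)) → Matrix (Fin p) (Fin p) ℝ, IsEstimator T →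
      ∃ A ∈ Θ, ∃ Q : ProbabilityMeasure (EuclideanSpace ℝ (Fin p)),
        c ≤ sampleLaw n ε A (Q : Measure _) {X | r ≤ opNorm (T X - A) ^ 2}) :
    c ≤ minimaxProb n p Θ ε r := by
  refine le_iInf₂ fun T hT => ?_
  obtain ⟨A, hA, Q, hQ⟩ := h T hT
  exact hQ.trans (le_iSup₂_of_le A hA (le_iSup
    (fun Q : ProbabilityMeasure (EuclideanSpace ℝ (Fin p)) =>
      sampleLaw n ε A (Q : Measure _) {X | r ≤ opNorm (T X - A) ^ 2}) Q))

lemma le_sq_opNorm_of_separated {p : ℕ} {T A B : Matrix (Fin p) (Fin p) ℝ} {d r : ℝ} (hd : 0 ≤ d)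
    (hAB : d ≤ opNorm (B - A)) (hr : r ≤ (d / 2) ^ 2) (hT : opNorm (T - A) ^ 2 < r) :
    r ≤ opNorm (T - B) ^ 2 := by
  have h1 : opNorm (T - A) < d / 2 := lt_of_pow_lt_pow_left₀ 2 (by linarith) (hT.trans_le hr)
  have h2 := opNorm_sub_le T A B
  exact hr.trans (pow_le_pow_left₀ (by linarith) (by linarith) 2)

lemma minimaxProb_contamination {n p s : ℕ} (hs : 1 ≤ s) (hp : 0 < p) {M ε r : ℝ} (hM : 0 < M)
    (h0 : 0 < ε) (h1 : ε ≤ 1) (hr : r ≤ (M / 2 * ε / 2) ^ 2) :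
    ENNReal.ofReal (1 / 2) ≤ minimaxProb n p (sparseClass p s ∩ boundedClass p M) ε r := by
  refine le_minimaxProb fun T hT => ?_
  set v : EuclideanSpace ℝ (Fin p) := EuclideanSpace.single ⟨0, hp⟩ 1
  have hv : ‖v‖ = 1 := by simp [v]
  have hmem : ∀ κ : ℝ, κ ^ 2 ≤ 1 →
      spikeMatrix (M / 2) κ v ∈ sparseClass p s ∩ boundedClass p M := fun κ hκ =>
    spikeMatrix_mem hM hκ hv (S := {⟨0, hp⟩}) (by simpa using hs) fun i hi => by
      have : i ≠ ⟨0, hp⟩ := by simpa using hi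
      simp [v, this]
  obtain ⟨Q, hQ⟩ := exists_contaminated_eq (half_pos hM) h0 h1 hv
  set A := spikeMatrix (M / 2) 0 v
  set B := spikeMatrix (M / 2) (√ε) v with hB
  have hsep : M / 2 * ε ≤ opNorm (B - A) := by
    simpa [Real.sq_sqrt h0.le] using le_opNorm_spikeMatrix_sub (a := M / 2) (√ε) hv v
  have hlaw : sampleLaw n ε A (Q : Measure _) = sampleLaw n ε B (multivariateGaussian 0 A) := by
    rw [sampleLaw, hQ, sampleLaw]
  have hprob : IsProbabilityMeasure (contaminated ε A (Q : Measure _)) := by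
    constructor
    simp only [contaminated, Measure.coe_add, Measure.coe_smul, Pi.add_apply, Pi.smul_apply,
      measure_univ, smul_eq_mul, mul_one]
    rw [← ENNReal.ofReal_add (by linarith) h0.le]
    simp
  have hprob' : IsProbabilityMeasure (sampleLaw n ε A (Q : Measure _)) := by
    rw [sampleLaw]; infer_instance
  set E : Set (Fin n → EuclideanSpace ℝ (Fin p)) := {X | r ≤ opNorm (T X - A) ^ 2} with hE
  have hEm : MeasurableSet E :=
    measurableSet_le measurable_const ((measurable_opNorm_sub hT A).pow_const 2)
  by_cases hcase : ENNReal.ofReal (1 / 2) ≤ sampleLaw n ε A (Q : Measure _) E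
  · exact ⟨A, hmem 0 (by norm_num), Q, hcase⟩
  · refine ⟨B, hmem _ (by rwa [Real.sq_sqrt h0.le]), ⟨multivariateGaussian 0 A, inferInstance⟩, ?_⟩
    rw [ProbabilityMeasure.coe_mk, ← hlaw]
    -- Both parameters generate the same law, so the events of a large error at `A` and at `B` cover
    -- the sample space and one has probability at least `1/2`.
    have hsub : Eᶜ ⊆ {X | r ≤ opNorm (T X - B) ^ 2} := fun X hX =>
      le_sq_opNorm_of_separated (by positivity) hsep hr (not_le.1 hX)
    refine le_trans ?_ (measure_mono hsub)
    by_contra! hlt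
    have hadd := prob_add_prob_compl (μ := sampleLaw n ε A (Q : Measure _)) hEm
    have := ENNReal.add_lt_add (not_le.1 hcase) hlt
    rw [hadd, ← ENNReal.ofReal_add (by norm_num) (by norm_num)] at this
    norm_num at this

lemma minimaxProb_sparse {n p s m : ℕ} (hs : 0 < s) (hm : 0 < m) (hp : s * m ≤ p)
    {M ε r κ t : ℝ} (hM : 0 < M) (h0 : 0 ≤ ε) (h1 : ε ≤ 1) (hκ : κ ^ 4 ≤ 1 / 2)
    (ht0 : 0 ≤ t) (ht : t ≤ Real.log (Real.exp 1 * m) / 32) (hκt : n * κ ^ 4 = t * s)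
    (hr : r ≤ (M / 2 * κ ^ 2 / 2) ^ 2) :
    ENNReal.ofReal (1 / 48) ≤ minimaxProb n p (sparseClass p s ∩ boundedClass p M) ε r := by
  refine le_minimaxProb fun T hT => ?_
  obtain ⟨e, he⟩ := exists_injective_prod hp
  have : Nonempty (Fin m) := ⟨⟨0, hm⟩⟩
  have hκ2 : κ ^ 2 ≤ 1 := by nlinarith [sq_nonneg (κ ^ 2)]
  have ha : 0 < M / 2 := half_pos hM
  set v : (Fin s → Fin m × Bool) → EuclideanSpace ℝ (Fin p) := blockVector e with hvdef
  have hv : ∀ ω, ‖v ω‖ = 1 := norm_blockVector hs he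
  have hmem : ∀ ω (κ : ℝ), κ ^ 2 ≤ 1 →
      spikeMatrix (M / 2) κ (v ω) ∈ sparseClass p s ∩ boundedClass p M := fun ω κ hκ =>
    spikeMatrix_mem hM hκ (hv ω) (S := Finset.univ.image fun b => e (b, (ω b).1))
      (Finset.card_image_le.trans (by simp)) fun i hi => blockVector_apply_eq_zero e ω hi
  set ω₀ : Fin s → Fin m × Bool := Classical.arbitrary _
  set A := spikeMatrix (M / 2) 0 (v ω₀) with hA
  set B : (Fin s → Fin m × Bool) → Matrix (Fin p) (Fin p) ℝ := fun ω =>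
    spikeMatrix (M / 2) κ (v ω) with hB
  set f : (Fin s → Fin m × Bool) → EuclideanSpace ℝ (Fin p) → ℝ≥0∞ := fun ω x =>
    spikeDensity κ (v ω) ((√(M / 2))⁻¹ • x) with hf
  have hfm : ∀ ω, Measurable (f ω) := fun ω =>
    (measurable_spikeDensity κ (v ω)).comp (measurable_const_smul _)
  set P := multivariateGaussian 0 A with hP
  have hPmap : P = (stdGaussian (EuclideanSpace ℝ (Fin p))).map (fun x => √(M / 2) • x) :=
    (stdGaussian_map_smul_eq ha (v ω₀)).symm
  have hPB : ∀ ω, multivariateGaussian 0 (B ω) = P.withDensity (f ω) := fun ω => by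
    rw [hPmap]; exact multivariateGaussian_spikeMatrix ha κ (v ω) (hv ω)
  set F : (Fin s → Fin m × Bool) → (Fin n → EuclideanSpace ℝ (Fin p)) → ℝ≥0∞ := fun ω X =>
    ∏ i, f ω (X i) with hF
  have hFm : ∀ ω, Measurable (F ω) := fun ω =>
    Finset.measurable_prod _ fun i _ => (hfm ω).comp (measurable_pi_apply i)
  have hlaw : ∀ ω, (Measure.pi fun _ : Fin n => multivariateGaussian 0 (B ω)) =
      (Measure.pi fun _ : Fin n => P).withDensity (F ω) := fun ω => by
    have : SigmaFinite (P.withDensity (f ω)) := by rw [← hPB]; infer_instance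
    simp_rw [hPB]
    exact pi_withDensity (fun _ : Fin n => P) (fun _ => f ω) fun _ => hfm ω
  have hpair : ∀ ω ω', ∫⁻ X, F ω X * F ω' X ∂(Measure.pi fun _ : Fin n => P) ≤
      ENNReal.ofReal (Real.exp (t * overlap ω ω' ^ 2 / s)) := fun ω ω' => by
    simp only [hF, ← Finset.prod_mul_distrib]
    rw [lintegral_pi_prod (fun _ : Fin n => P) (fun _ x => f ω x * f ω' x)
      fun _ => (hfm ω).mul (hfm ω'), Finset.prod_const, Finset.card_univ, Fintype.card_fin]
    have h2 : ∫⁻ x, f ω x * f ω' x ∂P ≤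
        ENNReal.ofReal (Real.exp (κ ^ 4 * ⟪v ω, v ω'⟫ ^ 2)) := by
      rw [hPmap, lintegral_map (f := fun x => f ω x * f ω' x) ((hfm ω).mul (hfm ω')) (by fun_prop)]
      simp only [hf, smul_smul, inv_mul_cancel₀ (Real.sqrt_pos.2 ha).ne', one_smul]
      exact lintegral_spikeDensity_mul_le hκ (hv ω) (hv ω')
    refine (pow_le_pow_left' h2 n).trans_eq ?_
    -- The exponent is `n κ⁴ (overlap/s)² = t overlap²/s`.
    rw [← ENNReal.ofReal_pow (Real.exp_pos _).le, ← Real.exp_nat_mul, hvdef,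
      inner_blockVector he, ← mul_assoc, hκt]
    have : (s : ℝ) ≠ 0 := by exact_mod_cast hs.ne'
    congr 2
    field_simp
  have hsec : ∑ ω, ∑ ω', ∫⁻ X, F ω X * F ω' X ∂(Measure.pi fun _ : Fin n => P) ≤
      ENNReal.ofReal 12 * (Fintype.card (Fin s → Fin m × Bool) : ℝ≥0∞) ^ 2 := by
    set N := Fintype.card (Fin s → Fin m × Bool) with hN
    have hNr : (N : ℝ) = (2 * m) ^ s := by simp [hN, mul_comm]
    have hrow : ∀ ω, ∑ ω', ∫⁻ X, F ω X * F ω' X ∂(Measure.pi fun _ : Fin n => P) ≤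
        ENNReal.ofReal 12 * N := fun ω => by
      calc _ ≤ ∑ ω', ENNReal.ofReal (Real.exp (t * overlap ω ω' ^ 2 / s)) :=
            Finset.sum_le_sum fun ω' _ => hpair ω ω'
        _ = ENNReal.ofReal (∑ ω', Real.exp (t * overlap ω ω' ^ 2 / s)) :=
            (ENNReal.ofReal_sum_of_nonneg fun _ _ => (Real.exp_pos _).le).symm
        _ ≤ ENNReal.ofReal (12 * N) := by
            rw [hNr]
            exact ENNReal.ofReal_le_ofReal (sum_exp_overlap_sq_le hs hm ht0 ht ω)
        _ = _ := by rw [ENNReal.ofReal_mul (by norm_num), ENNReal.ofReal_natCast]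
    calc _ ≤ ∑ _ω : Fin s → Fin m × Bool, ENNReal.ofReal 12 * (N : ℝ≥0∞) :=
          Finset.sum_le_sum fun ω _ => hrow ω
      _ = _ := by
          rw [Finset.sum_const, Finset.card_univ, ← hN, nsmul_eq_mul]; ring
  have hself : ∀ A' : Matrix (Fin p) (Fin p) ℝ,
      sampleLaw n ε A' (multivariateGaussian 0 A') =
        Measure.pi fun _ : Fin n => multivariateGaussian 0 A' := fun A' => by
    rw [sampleLaw, contaminated_self h0 h1]
  set E : Set (Fin n → EuclideanSpace ℝ (Fin p)) := {X | r ≤ opNorm (T X - A) ^ 2} with hE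
  have hEm : MeasurableSet E :=
    measurableSet_le measurable_const ((measurable_opNorm_sub hT A).pow_const 2)
  by_cases hcase : ENNReal.ofReal (1 / 48) ≤ (Measure.pi fun _ : Fin n => P) E
  · refine ⟨A, hmem ω₀ 0 (by norm_num), ⟨multivariateGaussian 0 A, inferInstance⟩, ?_⟩
    rw [ProbabilityMeasure.coe_mk, hself]
    exact hcase
  -- Le Cam is applied to `Eᶜ`, where the estimate is close to `A`; the threshold `1/48` is `1/(4K)`
  -- with `K = 12`.
  · obtain ⟨ω, hω⟩ := exists_half_le_of_second_moment (Measure.pi fun _ : Fin n => P) F hFm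
      (fun ω => by rw [← hlaw]; infer_instance) (K := 12) (by norm_num) hsec hEm.compl
      (by rw [compl_compl]; norm_num at hcase ⊢; exact hcase)
    refine ⟨B ω, hmem ω κ hκ2, ⟨multivariateGaussian 0 (B ω), inferInstance⟩, ?_⟩
    rw [ProbabilityMeasure.coe_mk, hself, hlaw]
    have hsub : Eᶜ ⊆ {X | r ≤ opNorm (T X - B ω) ^ 2} := fun X hX =>
      le_sq_opNorm_of_separated (by positivity)
        (le_opNorm_spikeMatrix_sub (a := M / 2) κ (hv ω) (v ω₀)) hr (not_le.1 hX)
    refine le_trans ?_ (hω.trans (measure_mono hsub))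
    exact ENNReal.ofReal_le_ofReal (by norm_num)

end SparseCov


theorem theorem3p7 (M : ℝ) (hM : 0 < M) (C₁ : ℝ) (hC₁ : 0 < C₁) :
    ∃ C c : ℝ, 0 < C ∧ 0 < c ∧
      ∀ n p s : ℕ, 0 < n → 1 ≤ s → s ≤ p → (p : ℝ) / (n : ℝ) ≤ C₁ →
        ∀ ε : ℝ, 0 ≤ ε → ε ≤ 1 →
          ENNReal.ofReal c ≤
            SparseCov.minimaxProb n p
              (SparseCov.sparseClass p s ∩ SparseCov.boundedClass p M) ε
              (C * max ((s : ℝ) * Real.log (Real.exp 1 * (p : ℝ) / (s : ℝ)) / (n : ℝ))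
                (ε ^ 2)) := by
  -- The first bound serves the overlap estimate, the second keeps `κ⁴ ≤ 1/2`.
  set lam : ℝ := min (1 / 32) (1 / (4 * C₁)) with hlam
  have hlam0 : 0 < lam := by positivity
  have hlam1 : lam ≤ 1 / 32 := min_le_left _ _
  have hlam2 : lam * C₁ ≤ 1 / 4 := by
    calc lam * C₁ ≤ 1 / (4 * C₁) * C₁ := by gcongr; exact min_le_right _ _
      _ = 1 / 4 := by field_simp
  refine ⟨M ^ 2 * lam / 32, 1 / 48, by positivity, by norm_num, ?_⟩
  intro n p s hn hs hsp hpn ε h0 h1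
  have hn' : (0 : ℝ) < n := by exact_mod_cast hn
  have hs' : (0 : ℝ) < s := by exact_mod_cast hs
  have hp' : (0 : ℝ) < p := by exact_mod_cast hs.trans hsp
  set ℓ := Real.log (Real.exp 1 * (p : ℝ) / (s : ℝ)) with hℓ
  have hℓ1 : 1 ≤ ℓ := by
    rw [hℓ, Real.le_log_iff_exp_le (by positivity), le_div_iff₀ hs']
    gcongr
  have hrate : 0 < s * ℓ / n := by positivity
  rcases le_total (ε ^ 2) (s * ℓ / n) with hcase | hcase
  · rw [max_eq_left hcase]
    set m := p / s with hm
    have hm0 : 0 < m := Nat.div_pos hsp hs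
    have hm' : (1 : ℝ) ≤ m := by exact_mod_cast hm0
    have hsm : s * m ≤ p := Nat.mul_div_le p s
    have hmp : (m : ℝ) ≤ p / s := Nat.cast_div_le
    have hpm : (p : ℝ) / s ≤ 2 * m := by
      have h : p < s * (m + 1) := Nat.lt_mul_div_succ p hs
      have h' : (p : ℝ) < s * (m + 1) := by exact_mod_cast h
      rw [div_le_iff₀ hs']
      nlinarith
    set u := Real.log (Real.exp 1 * m) with hu
    have hu1 : 1 ≤ u := by
      rw [hu, Real.le_log_iff_exp_le (by positivity)]
      nlinarith [Real.exp_pos 1]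
    have huℓ : u ≤ ℓ := by
      refine Real.log_le_log (by positivity) ?_
      rw [mul_div_assoc]
      gcongr
    -- Rounding `p / s` down to `m` costs at most `log 2 < 1 ≤ u`, hence a factor two in the rate.
    have hℓu : ℓ ≤ 2 * u := by
      have h2 : ℓ ≤ Real.log (2 * (Real.exp 1 * m)) := by
        refine Real.log_le_log (by positivity) ?_
        rw [mul_div_assoc, mul_left_comm]
        gcongr
      rw [Real.log_mul two_ne_zero (by positivity)] at h2
      have := Real.log_two_lt_d9
      linarith
    have hℓp : s * ℓ ≤ p := by
      have h2 : ℓ ≤ p / s := by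
        rw [hℓ, mul_div_assoc, Real.log_mul (Real.exp_pos 1).ne' (by positivity), Real.log_exp]
        linarith [Real.log_le_sub_one_of_pos (show 0 < (p : ℝ) / s by positivity)]
      calc s * ℓ ≤ s * (p / s) := by gcongr
        _ = p := by field_simp
    -- Chosen so that `n κ⁴ = t s` with `t = lam * u`; then `κ⁴ ≤ lam * (p / n)` by `hℓp`.
    set κ := √(√(lam * (s * u / n))) with hκ
    have hκ2 : κ ^ 2 = √(lam * (s * u / n)) := Real.sq_sqrt (Real.sqrt_nonneg _)
    have hκ4 : κ ^ 4 = lam * (s * u / n) := by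
      rw [show κ ^ 4 = (κ ^ 2) ^ 2 by ring, hκ2, Real.sq_sqrt (by positivity)]
    refine SparseCov.minimaxProb_sparse (m := m) (κ := κ) (t := lam * u) hs hm0 hsm hM h0 h1
      ?_ (by positivity) (by nlinarith) (by rw [hκ4]; field_simp) ?_
    · rw [hκ4]
      calc lam * (s * u / n) ≤ lam * (s * ℓ / n) := by gcongr
        _ ≤ lam * (p / n) := by gcongr
        _ ≤ lam * C₁ := by gcongr
        _ ≤ 1 / 2 := by linarith
    · calc M ^ 2 * lam / 32 * (s * ℓ / n) ≤ M ^ 2 * lam / 32 * (s * (2 * u) / n) := by gcongr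
        _ = M ^ 2 / 16 * (lam * (s * u / n)) := by ring
        _ = (M / 2 * κ ^ 2 / 2) ^ 2 := by rw [← hκ4]; ring
        _ ≤ _ := le_rfl
  · rw [max_eq_right hcase]
    -- In this case `ε²` dominates the strictly positive sparse rate.
    have hε : 0 < ε := by
      rcases h0.eq_or_lt with h | h
      · rw [← h] at hcase; norm_num at hcase; linarith
      · exact h
    refine le_trans (ENNReal.ofReal_le_ofReal (by norm_num))
      (SparseCov.minimaxProb_contamination hs (hs.trans hsp) hM hε h1 ?_)
    have : M ^ 2 * lam / 32 * ε ^ 2 ≤ M ^ 2 * 2 / 32 * ε ^ 2 := by gcongr; linarith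
    linarith [show M ^ 2 * 2 / 32 * ε ^ 2 = (M / 2 * ε / 2) ^ 2 by ring]
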